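/- Consider a shared-memory switch with $N\ge 0$ output queues and a shared buffer of integer size $B\ge 0$. All packets are uniform (unit size and value) and integral. Time is slotted, $t=0,1,2,\dots$, and the buffer is empty at the start. An instance is a sequence $\tau:\mathbb N\to\{0,1,\dots,B\}^N$, where $\tau(t)_i$ is the number of packets for queue $i$ that arrive in slot $t$; it has finite duration if $\tau(t)=0$ for all sufficiently large $t$. Each slot has two phases. In the arrival phase an algorithm may accept any of the arriving packets and push out any of the stored ones, subject to at most $B$ packets being in the buffer in total after this phase. In the transmission phase every nonempty queue sends out exactly one packet. A deterministic online algorithm for given $(N,B)$ decides in slot $t$ as a function of $\tau(0),\dots,\tau(t)$ only. Write $\mathrm{ALG}(\tau)$ for the total number of packets that an algorithm $\mathrm{ALG}$ transmits on $\tau$, and $\mathrm{OPT}(\tau)$ for the maximum total number of packets that can be transmitted on $\tau$ with full knowledge of $\tau$. The competitive ratio of $\mathrm{ALG}$ for parameters $(N,B)$ is $$\alpha_{\mathrm{ALG}}(N,B)=\sup_{\tau\text{ of finite duration}}\frac{\mathrm{OPT}(\tau)}{\mathrm{ALG}(\tau)}\in[0,\infty],$$ with the conventions $x/0=\infty$ for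 $x>0$ and $0/0=0$. Theorem. Every deterministic online buffer management algorithm has competitive ratio at least $\sqrt2$: if $\mathrm{ALG}$ prescribes a deterministic online algorithm for every pair $(N,B)$ (in a way that may depend arbitrarily on $N$ and $B$), then $$\sup_{N,B}\ \alpha_{\mathrm{ALG}}(N,B)\ \ge\ \sqrt2 .$$ Equivalently, for every $\varepsilon>0$ there are $N$ and $B$ such that every deterministic online algorithm for a switch with $N$ queues and buffer size $B$ has competitive ratio greater than $\sqrt2-\varepsilon$. -/

import Mathlib

open scoped ENNReal

namespace SharedMemorySwitch

/-- An input instance for a switch with `N` output queues and a shared buffer of size `B`: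
`τ t i` is the number of packets destined to queue `i` that arrive in time slot `t`. -/
abbrev Instance (N B : ℕ) : Type := ℕ → Fin N → Fin (B + 1)

/-- No packet arrives after some time slot `T`. -/
def Instance.FiniteDuration {N B : ℕ} (τ : Instance N B) : Prop :=
  ∃ T : ℕ, ∀ t : ℕ, T < t → ∀ i : Fin N, (τ t i : ℕ) = 0

/-- A schedule records `s t i`, the number of packets kept in queue `i` after the arrival phase of
time slot `t` (after admission and push-out, just before transmission). -/
abbrev Schedule (N : ℕ) : Type := ℕ → Fin N → ℕ

/-- Queue lengths at the beginning of a time slot. The buffer is empty at time `0`; in the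
transmission phase every nonempty queue sends out one packet, so that a queue of length `n` becomes
one of length `max 0 (n - 1)`, which is the truncated difference in `ℕ`. -/
def Schedule.queue {N : ℕ} (s : Schedule N) : ℕ → Fin N → ℕ
  | 0, _ => 0
  | t + 1, i => s t i - 1

/-- In every arrival phase, the kept packets are among the stored and the newly arrived ones (any
arriving packet may be rejected and any stored packet may be pushed out), and they fit in the shared
buffer. -/
structure Schedule.IsFeasible {N B : ℕ} (τ : Instance N B) (s : Schedule N) : Prop where
  kept_le : ∀ (t : ℕ) (i : Fin N), s t i ≤ s.queue t i + (τ t i : ℕ)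
  capacity : ∀ t : ℕ, ∑ i : Fin N, s t i ≤ B

/-- The total number of transmitted packets, over all time: in each time slot, one for every queue
that is nonempty after the arrival phase. -/
noncomputable def Schedule.transmitted {N : ℕ} (s : Schedule N) : ℝ≥0∞ :=
  ∑' t : ℕ, (((Finset.univ.filter fun i : Fin N => 0 < s t i).card : ℕ) : ℝ≥0∞)

/-- A deterministic online buffer management algorithm: it produces a feasible schedule for every
instance, and what it keeps in time slot `t` depends only on the arrivals up to time `t`. -/
structure OnlineAlgorithm (N B : ℕ) where
  run : Instance N B → Schedule N
  feasible : ∀ τ : Instance N B, (run τ).IsFeasible τ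
  online : ∀ (τ τ' : Instance N B) (t : ℕ), (∀ u ≤ t, τ u = τ' u) → run τ t = run τ' t

/-- The number of packets transmitted by the optimal offline (clairvoyant) algorithm on `τ`. -/
noncomputable def optTransmitted {N B : ℕ} (τ : Instance N B) : ℝ≥0∞ :=
  ⨆ (s : Schedule N) (_ : s.IsFeasible τ), s.transmitted

/-- The competitive ratio of an algorithm for a switch with parameters `N` and `B`: the supremum of
`OPT(τ) / ALG(τ)` over the instances of finite duration. In `ℝ≥0∞`, `x / 0 = ∞` for `x ≠ 0`, and
instances on which nothing can be transmitted contribute `0 / 0 = 0`, so they do not matter. -/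
noncomputable def OnlineAlgorithm.competitiveRatio {N B : ℕ} (A : OnlineAlgorithm N B) : ℝ≥0∞ :=
  ⨆ (τ : Instance N B) (_ : τ.FiniteDuration), optTransmitted τ / (A.run τ).transmitted

end SharedMemorySwitch

namespace SharedMemorySwitch

open Finset

/-! An adversary keeps `n + 1` queues active, floods each with `B` packets per slot, and at the end
of each slot closes the one that the algorithm keeps shortest, opening a fresh queue in its place.
Let `e u` be the number of packets that `q u` still sends from its closing slot on. The `n`
survivors are at least as long as `q u`, and a closed queue that drains for `e u` slots occupies at
least `e u * (e u + 1) / 2` packet-slots. Summing the buffer constraint over time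
(`sum_closedTransmitted_le`) bounds the average of `n * e u + e u ^ 2 / 2` by about `B`, which is
about `n ^ 2 / 2`. By Cauchy–Schwarz the average of `e u + n`, hence the throughput per slot, is at
most about `√2 * n` (`sum_closed_le_sqrt_two`). Knowing the closing order, one packet suffices in
each survivor and `n` in the queue being closed, for a throughput of `2 * n` per slot
(`le_optTransmitted`). The ratio tends to `√2` as `n` grows. -/

/-! ### Two facts about sequences -/

/-- A causal rule determines a sequence. -/
lemma exists_causal_fixedPoint {α : Type*} [Nonempty α] (F : ℕ → (ℕ → α) → α)
    (hF : ∀ t q q', (∀ u < t, q u = q' u) → F t q = F t q') : ∃ q : ℕ → α, ∀ t, q t = F t q := by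
  classical
  -- `g t` has its final values below `t`; the other entries are arbitrary.
  let g : ℕ → ℕ → α := fun t => Nat.rec (fun _ => Classical.arbitrary α)
    (fun s h => Function.update h s (F s h)) t
  have hg : ∀ s, g (s + 1) = Function.update (g s) s (F s (g s)) := fun s => rfl
  have hstable : ∀ u j, g (u + 1 + j) u = g (u + 1) u := by
    intro u j
    induction j with
    | zero => rfl
    | succ j ih =>
      rw [← Nat.add_assoc, hg, Function.update_of_ne (by omega), ih]
  refine ⟨fun t => g (t + 1) t, fun t => ?_⟩
  have h1 : g (t + 1) t = F t (g t) := by rw [hg, Function.update_self]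
  show g (t + 1) t = _
  rw [h1]
  refine hF _ _ _ fun u hu => ?_
  obtain ⟨j, rfl⟩ := Nat.exists_eq_add_of_lt hu
  have := hstable u j
  rwa [show u + 1 + j = u + j + 1 by ring] at this

/-- A sequence that loses at least one in every step is positive for at most as many steps as its
first value, and its sum is at least the triangular number of the number of these steps. -/
lemma card_pos_le_and_triangle_le (L : ℕ) : ∀ f : ℕ → ℕ, (∀ j, f (j + 1) ≤ f j - 1) →
    (∑ j ∈ range L, if 0 < f j then 1 else 0) ≤ f 0 ∧
    (∑ j ∈ range L, if 0 < f j then 1 else 0) * ((∑ j ∈ range L, if 0 < f j then 1 else 0) + 1)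
      ≤ 2 * ∑ j ∈ range L, f j := by
  induction L with
  | zero => intro f _; simp
  | succ L ih =>
    intro f hf
    obtain ⟨h1, h2⟩ := ih (fun j => f (j + 1)) fun j => hf (j + 1)
    rw [sum_range_succ', sum_range_succ']
    set e := ∑ j ∈ range L, if 0 < f (j + 1) then 1 else 0
    have h0 := hf 0
    simp only [zero_add] at h1 h0
    by_cases hp : 0 < f 0
    · rw [if_pos hp]
      refine ⟨by omega, ?_⟩
      have : e + 1 ≤ f 0 := by omega
      nlinarith
    · rw [if_neg hp]
      have : e = 0 := by omega
      simp [this]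

/-! ### The adversarial instance -/

variable {N : ℕ}

/-- The queues that are open and have not been closed before slot `t`, when the queues
`0, …, n + t` are open in slot `t` and `q u` is closed in slot `u`. -/
def active (n : ℕ) (q : ℕ → Fin N) (t : ℕ) : Finset (Fin N) :=
  univ.filter fun i => (i : ℕ) < n + t + 1 ∧ ∀ u < t, q u ≠ i

/-- The open queues that are not closed up to and including slot `t`. -/
def surviving (n T : ℕ) (q : ℕ → Fin N) (t : ℕ) : Finset (Fin N) :=
  univ.filter fun i => (i : ℕ) < n + t + 1 ∧ ∀ u < T, u ≤ t → q u ≠ i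

/-- The instance in which every active queue receives a burst of `B` packets in each of the first
`T` slots. -/
def burstInstance (B n T : ℕ) (q : ℕ → Fin N) : Instance N B :=
  fun t i => if t < T ∧ i ∈ active n q t then Fin.last B else 0

/-- The slots up to `t`, among the first `T`. -/
def slotsUpTo (T t : ℕ) : Finset ℕ := (range T).filter (· ≤ t)

lemma mem_slotsUpTo {T t u : ℕ} : u ∈ slotsUpTo T t ↔ u < T ∧ u ≤ t := by
  simp [slotsUpTo]

lemma active_congr (n : ℕ) {q q' : ℕ → Fin N} {t : ℕ} (h : ∀ u < t, q u = q' u) :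
    active n q t = active n q' t := by
  ext i
  simp only [active, mem_filter, mem_univ, true_and]
  refine and_congr_right fun _ => forall₂_congr fun u hu => ?_
  rw [h u hu]

lemma burstInstance_congr (B n T : ℕ) {q q' : ℕ → Fin N} {t : ℕ} (h : ∀ u < t, q u = q' u) :
    burstInstance B n T q t = burstInstance B n T q' t := by
  funext i
  simp only [burstInstance, active_congr n h]

lemma burstInstance_finiteDuration (B n T : ℕ) (q : ℕ → Fin N) :
    (burstInstance B n T q).FiniteDuration := by
  refine ⟨T, fun t ht i => ?_⟩
  have : ¬ t < T := by omega
  simp [burstInstance, this]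

lemma ne_of_mem_active {n T : ℕ} {q : ℕ → Fin N} (hq : ∀ t < T, q t ∈ active n q t) {u v : ℕ}
    (hv : v < T) (huv : u < v) : q u ≠ q v := by
  have := hq v hv
  simp only [active, mem_filter] at this
  exact this.2.2 u huv

lemma injOn_of_mem_active {n T : ℕ} {q : ℕ → Fin N} (hq : ∀ t < T, q t ∈ active n q t) (t : ℕ) :
    Set.InjOn q (slotsUpTo T t) := by
  intro u hu v hv huv
  rw [mem_coe, mem_slotsUpTo] at hu hv
  rcases lt_trichotomy u v with h | h | h
  · exact absurd huv (ne_of_mem_active hq hv.1 h)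
  · exact h
  · exact absurd huv.symm (ne_of_mem_active hq hu.1 h)

lemma surviving_subset_active {n T : ℕ} {q : ℕ → Fin N} {t : ℕ} (ht : t < T) :
    surviving n T q t ⊆ active n q t := by
  intro i hi
  simp only [surviving, active, mem_filter, mem_univ, true_and] at hi ⊢
  exact ⟨hi.1, fun u hu => hi.2 u (by omega) (by omega)⟩

lemma disjoint_surviving_image (n T : ℕ) (q : ℕ → Fin N) (t : ℕ) :
    Disjoint (surviving n T q t) ((slotsUpTo T t).image q) := by
  rw [disjoint_left]
  intro i hi hi'
  obtain ⟨u, hu, rfl⟩ := mem_image.1 hi'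
  rw [mem_slotsUpTo] at hu
  exact (mem_filter.1 hi).2.2 u hu.1 hu.2 rfl

lemma card_slotsUpTo (T t : ℕ) : (slotsUpTo T t).card = min T (t + 1) := by
  rw [← card_range (min T (t + 1))]
  congr 1
  ext u
  rw [mem_slotsUpTo, mem_range]
  omega

/-- Of the `n + min T (t + 1)` open queues, `min T (t + 1)` distinct ones are closed. -/
lemma card_surviving {n T : ℕ} {q : ℕ → Fin (n + T)} (hq : ∀ t < T, q t ∈ active n q t) (t : ℕ) :
    (surviving n T q t).card = n := by
  have hunion : (univ.filter fun i : Fin (n + T) => (i : ℕ) < n + t + 1)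
      = surviving n T q t ∪ (slotsUpTo T t).image q := by
    ext i
    simp only [surviving, mem_union, mem_filter, mem_univ, true_and, mem_image, mem_slotsUpTo]
    constructor
    · intro hi
      by_cases h : ∃ u, (u < T ∧ u ≤ t) ∧ q u = i
      · exact Or.inr h
      · exact Or.inl ⟨hi, fun u hu hut hui => h ⟨u, ⟨hu, hut⟩, hui⟩⟩
    · rintro (h | ⟨u, ⟨hu, hut⟩, rfl⟩)
      · exact h.1
      · have := hq u hu
        simp only [active, mem_filter] at this
        omega
  have hcard := congrArg card hunion
  rw [Fin.card_filter_val_lt, card_union_of_disjoint (disjoint_surviving_image n T q t),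
    card_image_of_injOn (injOn_of_mem_active hq t), card_slotsUpTo] at hcard
  omega

lemma active_nonempty {n T : ℕ} (q : ℕ → Fin (n + T)) {t : ℕ} (ht : t < T) :
    (active n q t).Nonempty := by
  have hsub : (univ.filter fun i : Fin (n + T) => (i : ℕ) < n + t + 1) \ (range t).image q
      ⊆ active n q t := by
    intro i hi
    simp only [active, mem_sdiff, mem_filter, mem_univ, true_and, mem_image, mem_range,
      not_exists, not_and] at hi ⊢
    exact hi
  have h1 := le_card_sdiff ((range t).image q)
    (univ.filter fun i : Fin (n + T) => (i : ℕ) < n + t + 1)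
  have h2 := card_image_le (s := range t) (f := q)
  have h3 := card_le_card hsub
  rw [Fin.card_filter_val_lt] at h1
  rw [card_range] at h2
  rw [← card_pos]
  omega

/-- Against every online algorithm, in each of the first `T` slots the active queue that the
algorithm keeps shortest can be closed. -/
lemma exists_shortest_closed {B n T : ℕ} (hT : 0 < T) (A : OnlineAlgorithm (n + T) B) :
    ∃ q : ℕ → Fin (n + T), ∀ t < T, q t ∈ active n q t ∧
      ∀ i ∈ active n q t, A.run (burstInstance B n T q) t (q t)
        ≤ A.run (burstInstance B n T q) t i := by
  have : Nonempty (Fin (n + T)) := ⟨⟨0, by omega⟩⟩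
  obtain ⟨q, hq⟩ := exists_causal_fixedPoint
    (fun t (q : ℕ → Fin (n + T)) => Classical.epsilon fun x => x ∈ active n q t ∧
      ∀ i ∈ active n q t, A.run (burstInstance B n T q) t x
        ≤ A.run (burstInstance B n T q) t i) (by
    intro t q q' h
    -- The choice is causal: arrivals up to slot `t` depend only on closures before `t`.
    have h1 : A.run (burstInstance B n T q) t = A.run (burstInstance B n T q') t :=
      A.online _ _ _ fun u hu => burstInstance_congr B n T fun v hv => h v (by omega)
    simp only [active_congr n h, h1])
  refine ⟨q, fun t ht => ?_⟩
  rw [hq t]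
  exact Classical.epsilon_spec (p := fun x => x ∈ active n q t ∧
    ∀ i ∈ active n q t, A.run (burstInstance B n T q) t x
      ≤ A.run (burstInstance B n T q) t i) (exists_min_image _ _ (active_nonempty q ht))

/-! ### Feasible schedules on the instance -/

section Feasible

variable {B n T : ℕ} {q : ℕ → Fin N} {s : Schedule N}

lemma step_of_no_arrival (hs : s.IsFeasible (burstInstance B n T q)) {t : ℕ} {i : Fin N}
    (h : ¬ (t + 1 < T ∧ i ∈ active n q (t + 1))) : s (t + 1) i ≤ s t i - 1 := by
  have := hs.kept_le (t + 1) i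
  simpa [burstInstance, h, Schedule.queue] using this

lemma step_closed (hs : s.IsFeasible (burstInstance B n T q)) {t u : ℕ} (hut : u ≤ t) :
    s (t + 1) (q u) ≤ s t (q u) - 1 := by
  refine step_of_no_arrival hs fun h => ?_
  exact (mem_filter.1 h.2).2.2 u (by omega) rfl

lemma eq_zero_of_unopened (hs : s.IsFeasible (burstInstance B n T q)) {t : ℕ} {i : Fin N}
    (h : n + t + 1 ≤ (i : ℕ)) : s t i = 0 := by
  induction t with
  | zero =>
    have := hs.kept_le 0 i
    have h' : i ∉ active n q 0 := by simp only [active, mem_filter]; omega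
    simpa [burstInstance, h', Schedule.queue] using this
  | succ t ih =>
    have h' : i ∉ active n q (t + 1) := by simp only [active, mem_filter]; omega
    have h1 := step_of_no_arrival hs (fun h => h' h.2) (t := t) (i := i)
    have h2 := ih (by omega)
    omega

lemma le_capacity (hs : s.IsFeasible (burstInstance B n T q)) (t : ℕ) (i : Fin N) : s t i ≤ B :=
  (single_le_sum (f := s t) (fun _ _ => Nat.zero_le _) (mem_univ i)).trans (hs.capacity t)

/-- Without arrivals, a queue of at most `B` packets drains within `B` slots. This makes the
throughput a finite sum. -/
lemma eq_zero_of_late (hs : s.IsFeasible (burstInstance B n T q)) {t : ℕ} (ht : T + B ≤ t)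
    (i : Fin N) : s t i = 0 := by
  have h : ∀ j, s (T + j) i ≤ B - j := by
    intro j
    induction j with
    | zero => exact le_capacity hs _ _
    | succ j ih =>
      have := step_of_no_arrival hs (t := T + j) (i := i) (by omega)
      rw [← Nat.add_assoc]
      omega
  have := h (t - T)
  rw [show T + (t - T) = t by omega] at this
  omega

lemma transmitted_eq (hs : s.IsFeasible (burstInstance B n T q)) :
    s.transmitted
      = ((∑ t ∈ range (T + B), (univ.filter fun i : Fin N => 0 < s t i).card : ℕ) : ℝ≥0∞) := by
  rw [Schedule.transmitted, tsum_eq_sum (s := range (T + B)), Nat.cast_sum]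
  intro t ht
  rw [mem_range, not_lt] at ht
  simp [eq_zero_of_late hs ht]

end Feasible

/-! ### Upper bound on the online throughput -/

lemma sum_slotsUpTo_comm (T S : ℕ) (g : ℕ → ℕ → ℕ) :
    ∑ t ∈ range S, ∑ u ∈ slotsUpTo T t, g t u
      = ∑ u ∈ range T, ∑ j ∈ range (S - u), g (u + j) u := by
  rw [sum_comm' (t' := range T) (s' := fun u => Ico u S)]
  · exact sum_congr rfl fun u _ => sum_Ico_eq_sum_range _ _ _
  · intro t u
    simp only [mem_range, mem_slotsUpTo, mem_Ico]
    omega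

section Accounting

variable {B n T : ℕ} {q : ℕ → Fin (n + T)} {s : Schedule (n + T)}

/-- The number of packets sent by `q u` from slot `u` on. -/
def closedTransmitted (B T : ℕ) (q : ℕ → Fin N) (s : Schedule N) (u : ℕ) : ℕ :=
  ∑ j ∈ range (T + B - u), if 0 < s (u + j) (q u) then 1 else 0

lemma card_nonempty_le (hs : s.IsFeasible (burstInstance B n T q))
    (hq : ∀ t < T, q t ∈ active n q t) (t : ℕ) :
    (univ.filter fun i => 0 < s t i).card
      ≤ n + ∑ u ∈ slotsUpTo T t, if 0 < s t (q u) then 1 else 0 := by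
  have hsub : (univ.filter fun i => 0 < s t i)
      ⊆ surviving n T q t ∪ ((slotsUpTo T t).filter fun u => 0 < s t (q u)).image q := by
    intro i hi
    simp only [mem_filter, mem_univ, true_and] at hi
    simp only [surviving, mem_union, mem_filter, mem_univ, true_and, mem_image, mem_slotsUpTo]
    by_cases h : ∃ u, (u < T ∧ u ≤ t) ∧ q u = i
    · obtain ⟨u, hu, rfl⟩ := h
      exact Or.inr ⟨u, ⟨hu, hi⟩, rfl⟩
    · refine Or.inl ⟨?_, fun u hu hut hui => h ⟨u, ⟨hu, hut⟩, hui⟩⟩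
      by_contra hn
      have := eq_zero_of_unopened hs (t := t) (i := i) (by omega)
      omega
  calc _ ≤ _ := card_le_card hsub
    _ ≤ _ := card_union_le _ _
    _ ≤ _ := by
      rw [card_surviving hq, ← card_filter]
      exact Nat.add_le_add_left card_image_le _

lemma sum_card_nonempty_le (hs : s.IsFeasible (burstInstance B n T q))
    (hq : ∀ t < T, q t ∈ active n q t) :
    ∑ t ∈ range (T + B), (univ.filter fun i => 0 < s t i).card
      ≤ n * (T + B) + ∑ u ∈ range T, closedTransmitted B T q s u := by
  calc _ ≤ ∑ t ∈ range (T + B), (n + ∑ u ∈ slotsUpTo T t, if 0 < s t (q u) then 1 else 0) :=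
        sum_le_sum fun t _ => card_nonempty_le hs hq t
    _ = _ := by
      rw [sum_add_distrib, sum_slotsUpTo_comm]
      simp [closedTransmitted, mul_comm]

/-- While bursts last, each of the `n` survivors is active and so at least as long as `q t`; the
closed queues are disjoint from them. -/
lemma buffer_le (hs : s.IsFeasible (burstInstance B n T q))
    (hq : ∀ t < T, q t ∈ active n q t ∧ ∀ i ∈ active n q t, s t (q t) ≤ s t i) (t : ℕ) :
    (if t < T then n * s t (q t) else 0) + ∑ u ∈ slotsUpTo T t, s t (q u) ≤ B := by
  have hq' : ∀ t < T, q t ∈ active n q t := fun t ht => (hq t ht).1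
  have h1 : (if t < T then n * s t (q t) else 0) ≤ ∑ i ∈ surviving n T q t, s t i := by
    split_ifs with ht
    · have := card_nsmul_le_sum (surviving n T q t) (s t) (s t (q t)) fun i hi =>
        (hq t ht).2 i (surviving_subset_active ht hi)
      rwa [card_surviving hq', smul_eq_mul] at this
    · exact Nat.zero_le _
  have h2 : ∑ u ∈ slotsUpTo T t, s t (q u) = ∑ i ∈ (slotsUpTo T t).image q, s t i :=
    (sum_image (injOn_of_mem_active hq' t)).symm
  calc _ ≤ ∑ i ∈ surviving n T q t ∪ (slotsUpTo T t).image q, s t i := by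
        rw [sum_union (disjoint_surviving_image n T q t), h2]
        exact Nat.add_le_add_right h1 _
    _ ≤ ∑ i, s t i := sum_le_sum_of_subset (subset_univ _)
    _ ≤ B := hs.capacity t

lemma sum_closedTransmitted_le (hs : s.IsFeasible (burstInstance B n T q))
    (hq : ∀ t < T, q t ∈ active n q t ∧ ∀ i ∈ active n q t, s t (q t) ≤ s t i) :
    ∑ u ∈ range T, (2 * n * closedTransmitted B T q s u + closedTransmitted B T q s u ^ 2)
      ≤ 2 * ((T + B) * B) := by
  have hsum := sum_le_sum fun t (_ : t ∈ range (T + B)) => buffer_le hs hq t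
  rw [sum_add_distrib, sum_slotsUpTo_comm, sum_const, card_range, smul_eq_mul] at hsum
  have hfirst : ∑ t ∈ range (T + B), (if t < T then n * s t (q t) else 0)
      = ∑ t ∈ range T, n * s t (q t) := by
    rw [← sum_filter]
    congr 1
    ext t
    simp only [mem_filter, mem_range]
    omega
  rw [hfirst, ← sum_add_distrib] at hsum
  refine le_trans ?_ (Nat.mul_le_mul_left 2 hsum)
  rw [mul_sum]
  refine sum_le_sum fun u _ => ?_
  -- From slot `u` on, `q u` receives nothing, so its lengths strictly decrease until it is empty.
  have h := card_pos_le_and_triangle_le (T + B - u) (fun j => s (u + j) (q u))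
    fun j => step_closed hs (Nat.le_add_right u j)
  change closedTransmitted B T q s u ≤ s u (q u) ∧
    closedTransmitted B T q s u * (closedTransmitted B T q s u + 1) ≤ _ at h
  nlinarith [Nat.mul_le_mul_left n h.1, h.2]

end Accounting

/-! ### Lower bound on the optimal throughput -/

/-- The schedule that keeps `n` packets in every queue in the slot in which it is closed, and one
packet in every other active queue. -/
def clairvoyant (n T : ℕ) (q : ℕ → Fin N) : Schedule N := fun t i =>
  (∑ u ∈ slotsUpTo T t, if q u = i then n - (t - u) else 0)
    + if t < T ∧ i ∈ surviving n T q t then 1 else 0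

section Clairvoyant

variable {B n T : ℕ} {q : ℕ → Fin (n + T)}

lemma clairvoyant_closed (hq : ∀ t < T, q t ∈ active n q t) {t u : ℕ} (hu : u < T) (hut : u ≤ t) :
    clairvoyant n T q t (q u) = n - (t - u) := by
  have hmem : u ∈ slotsUpTo T t := mem_slotsUpTo.2 ⟨hu, hut⟩
  have hns : q u ∉ surviving n T q t := fun h => (mem_filter.1 h).2.2 u hu hut rfl
  rw [clairvoyant, if_neg (fun h => hns h.2), sum_eq_single_of_mem u hmem, if_pos rfl, add_zero]
  intro v hv hvu
  rw [if_neg fun h => hvu (injOn_of_mem_active hq t (mem_coe.2 hv) (mem_coe.2 hmem) h)]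

lemma clairvoyant_not_closed {t : ℕ} {i : Fin (n + T)} (h : ∀ u < T, u ≤ t → q u ≠ i) :
    clairvoyant n T q t i = if t < T ∧ i ∈ surviving n T q t then 1 else 0 := by
  rw [clairvoyant, sum_eq_zero, zero_add]
  intro u hu
  rw [mem_slotsUpTo] at hu
  rw [if_neg (h u hu.1 hu.2)]

lemma sum_range_tsub_mul_two_le (n k : ℕ) : (∑ u ∈ range k, (n - u)) * 2 ≤ n * (n + 1) := by
  induction n generalizing k with
  | zero => simp
  | succ n ih =>
    cases k with
    | zero => simp
    | succ k =>
      rw [sum_range_succ']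
      simp only [Nat.add_sub_add_right, Nat.sub_zero]
      nlinarith [ih k]

lemma sum_slotsUpTo_tsub_mul_two_le (n T t : ℕ) :
    (∑ u ∈ slotsUpTo T t, (n - (t - u))) * 2 ≤ n * (n + 1) := by
  have h1 : ∑ u ∈ slotsUpTo T t, (n - (t - u)) ≤ ∑ u ∈ range (t + 1), (n - (t - u)) := by
    refine sum_le_sum_of_subset fun u hu => ?_
    rw [mem_slotsUpTo] at hu
    rw [mem_range]
    omega
  have h2 : ∑ u ∈ range (t + 1), (n - (t - u)) = ∑ u ∈ range (t + 1), (n - u) := by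
    rw [← sum_range_reflect]
    refine sum_congr rfl fun u hu => ?_
    rw [mem_range] at hu
    congr 1
    omega
  exact (Nat.mul_le_mul_right 2 (h1.trans h2.le)).trans (sum_range_tsub_mul_two_le n (t + 1))

/-- Closed queues hold at most `n + (n - 1) + ⋯ + 1` packets and survivors at most `n`, in total `n
* (n + 3) / 2 = B`. -/
lemma clairvoyant_isFeasible (hq : ∀ t < T, q t ∈ active n q t) (hn : 1 ≤ n)
    (hB : 2 * B = n * (n + 3)) :
    (clairvoyant n T q).IsFeasible (burstInstance B n T q) := by
  have hnB : n ≤ B := by nlinarith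
  refine ⟨fun t i => ?_, fun t => ?_⟩
  · have hburst : ∀ x ≤ B, t < T → i ∈ active n q t →
        x ≤ (clairvoyant n T q).queue t i + (burstInstance B n T q t i : ℕ) := by
      intro x hx ht hi
      simp only [burstInstance, ht, hi, and_self, if_true, Fin.val_last]
      omega
    by_cases h : ∃ u, (u < T ∧ u ≤ t) ∧ q u = i
    · obtain ⟨u, ⟨hu, hut⟩, rfl⟩ := h
      rw [clairvoyant_closed hq hu hut]
      rcases hut.eq_or_lt with rfl | hlt
      · exact hburst _ (by omega) hu (hq u hu)
      · obtain ⟨t, rfl⟩ : ∃ v, t = v + 1 := ⟨t - 1, by omega⟩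
        rw [Schedule.queue, clairvoyant_closed hq hu (by omega)]
        omega
    · have h' : ∀ u < T, u ≤ t → q u ≠ i := fun u hu hut hui => h ⟨u, ⟨hu, hut⟩, hui⟩
      rw [clairvoyant_not_closed h']
      split_ifs with hi
      · exact hburst _ (by omega) hi.1 (surviving_subset_active hi.1 hi.2)
      · exact Nat.zero_le _
  · have h1 : ∑ i, clairvoyant n T q t i ≤ ∑ u ∈ slotsUpTo T t, (n - (t - u)) + n := by
      simp only [clairvoyant]
      rw [sum_add_distrib, sum_comm]
      refine Nat.add_le_add (le_of_eq (sum_congr rfl fun u _ => by simp)) ?_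
      rw [← card_filter]
      calc _ ≤ (surviving n T q t).card := card_le_card fun i hi => (mem_filter.1 hi).2.2
        _ = n := card_surviving hq t
    have h2 := sum_slotsUpTo_tsub_mul_two_le n T t
    nlinarith

lemma le_card_clairvoyant (hq : ∀ t < T, q t ∈ active n q t) (t : ℕ) :
    (if t < T then n else 0) + ∑ u ∈ slotsUpTo T t, (if t - u < n then 1 else 0)
      ≤ (univ.filter fun i => 0 < clairvoyant n T q t i).card := by
  have h1 : (if t < T then n else 0) = (if t < T then surviving n T q t else ∅).card := by
    split_ifs
    · rw [card_surviving hq]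
    · rfl
  have h2 : ∑ u ∈ slotsUpTo T t, (if t - u < n then 1 else 0)
      = (((slotsUpTo T t).filter fun u => t - u < n).image q).card := by
    rw [card_image_of_injOn, card_filter]
    exact (injOn_of_mem_active hq t).mono (coe_subset.2 (filter_subset _ _))
  rw [h1, h2, ← card_union_of_disjoint]
  · refine card_le_card fun i hi => ?_
    rw [mem_filter]
    refine ⟨mem_univ _, ?_⟩
    rcases mem_union.1 hi with h | h
    · split_ifs at h with ht
      · rw [clairvoyant, if_pos ⟨ht, h⟩]
        omega
      · simp at h
    · obtain ⟨u, hu, rfl⟩ := mem_image.1 h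
      rw [mem_filter, mem_slotsUpTo] at hu
      rw [clairvoyant_closed hq hu.1.1 hu.1.2]
      omega
  · refine Disjoint.mono ?_ (image_subset_image (filter_subset _ _))
      (disjoint_surviving_image n T q t)
    split_ifs
    · exact subset_rfl
    · exact empty_subset _

lemma le_optTransmitted (hq : ∀ t < T, q t ∈ active n q t) (hn : 1 ≤ n)
    (hB : 2 * B = n * (n + 3)) :
    ((2 * n * T : ℕ) : ℝ≥0∞) ≤ optTransmitted (burstInstance B n T q) := by
  have hnB : n ≤ B := by nlinarith
  have hf := clairvoyant_isFeasible hq hn hB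
  refine le_trans ?_ (le_iSup₂ (f := fun (s : Schedule (n + T))
    (_ : s.IsFeasible (burstInstance B n T q)) => s.transmitted) _ hf)
  rw [transmitted_eq hf]
  refine Nat.cast_le.2 ?_
  refine le_trans ?_ (sum_le_sum fun t _ => le_card_clairvoyant hq t)
  rw [sum_add_distrib, sum_slotsUpTo_comm]
  have h1 : ∑ t ∈ range (T + B), (if t < T then n else 0) = n * T := by
    rw [← sum_filter, show (range (T + B)).filter (· < T) = range T by
      ext t; simp only [mem_filter, mem_range]; omega]
    simp [mul_comm]
  -- Since `u < T` and `n ≤ B`, each closed queue has time to send all its `n` packets.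
  have h2 : n * T ≤ ∑ u ∈ range T, ∑ j ∈ range (T + B - u), if u + j - u < n then 1 else 0 := by
    have := card_nsmul_le_sum (range T)
      (fun u => ∑ j ∈ range (T + B - u), if u + j - u < n then 1 else 0) n (by
        intro u hu
        rw [mem_range] at hu
        rw [← card_filter]
        calc n = (range n).card := (card_range n).symm
          _ ≤ _ := card_le_card fun j hj => by
            rw [mem_range] at hj
            rw [mem_filter, mem_range]
            omega)
    simpa [mul_comm] using this
  rw [h1]
  linarith

end Clairvoyant

/-! ### Comparing the two bounds -/

/-- Completing the square turns `he` into a bound on the sum of `(e u + n) ^ 2`. With `T = B ^ 2`,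
the `B` draining slots only affect lower-order terms. -/
lemma sum_closed_le_sqrt_two {B n T : ℕ} (hn : 1 ≤ n) (hB : 2 * B = n * (n + 3)) (hT : T = B ^ 2)
    (e : ℕ → ℕ) (he : ∑ u ∈ range T, (2 * n * e u + e u ^ 2) ≤ 2 * ((T + B) * B)) :
    ((n * (T + B) + ∑ u ∈ range T, e u : ℕ) : ℝ) ≤ T * (√2 * n + 3) := by
  have hnB : (n : ℝ) ≤ B := by exact_mod_cast (show n ≤ B by nlinarith)
  have hn' : (1 : ℝ) ≤ n := by exact_mod_cast hn
  have hB' : (2 : ℝ) * B = n * (n + 3) := by exact_mod_cast hB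
  have hT' : (T : ℝ) = B ^ 2 := by exact_mod_cast hT
  have he' : ∑ u ∈ range T, (2 * (n : ℝ) * e u + (e u : ℝ) ^ 2) ≤ 2 * (((T : ℝ) + B) * B) := by
    exact_mod_cast he
  have hs2 : √2 ^ 2 = 2 := Real.sq_sqrt (by norm_num)
  have hs1 : 1 ≤ √2 := Real.one_le_sqrt.2 (by norm_num)
  have hcs := sq_sum_le_card_mul_sum_sq (s := range T) (f := fun u => (e u : ℝ) + n)
  have hexp : ∑ u ∈ range T, ((e u : ℝ) + n) ^ 2
      = ∑ u ∈ range T, (2 * (n : ℝ) * e u + (e u : ℝ) ^ 2) + T * n ^ 2 := by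
    rw [show (T : ℝ) * n ^ 2 = ∑ u ∈ range T, (n : ℝ) ^ 2 by simp, ← sum_add_distrib]
    exact sum_congr rfl fun u _ => by ring
  rw [hexp, card_range, sum_add_distrib] at hcs
  simp only [sum_const, card_range, nsmul_eq_mul] at hcs
  have hTpos : (0 : ℝ) ≤ T := Nat.cast_nonneg T
  have hbound : ∑ u ∈ range T, (e u : ℝ) + T * n ≤ T * (√2 * n + 2) := by
    refine le_of_sq_le_sq ?_ (by positivity)
    refine hcs.trans ?_
    have h1 : 2 * (((T : ℝ) + B) * B) = T * (n * (n + 3) + 2) := by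
      rw [hT', ← hB']; ring
    have h2 : ∑ u ∈ range T, (2 * (n : ℝ) * e u + (e u : ℝ) ^ 2) + T * n ^ 2
        ≤ T * (√2 * n + 2) ^ 2 := by
      have : (n : ℝ) * (n + 3) + 2 + n ^ 2 ≤ (√2 * n + 2) ^ 2 := by nlinarith
      nlinarith
    calc _ ≤ (T : ℝ) * (T * (√2 * n + 2) ^ 2) := mul_le_mul_of_nonneg_left h2 hTpos
      _ = _ := by ring
  -- The draining phase contributes at most `n * B`, which raises the constant from `2` to `3`.
  have hnBT : (n : ℝ) * B ≤ T := by rw [hT']; nlinarith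
  push_cast
  linarith

lemma le_competitiveRatio {B n T : ℕ} (hn : 1 ≤ n) (hB : 2 * B = n * (n + 3)) (hT : T = B ^ 2)
    (A : OnlineAlgorithm (n + T) B) :
    ENNReal.ofReal (2 * n / (√2 * n + 3)) ≤ A.competitiveRatio := by
  have hTpos : 0 < T := by
    have : 0 < B := by nlinarith
    rw [hT]; positivity
  obtain ⟨q, hq⟩ := exists_shortest_closed hTpos A
  have hq' : ∀ t < T, q t ∈ active n q t := fun t ht => (hq t ht).1
  have hs := A.feasible (burstInstance B n T q)
  have halg : (A.run (burstInstance B n T q)).transmitted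
      ≤ ENNReal.ofReal (T * (√2 * n + 3)) := by
    rw [transmitted_eq hs, ← ENNReal.ofReal_natCast]
    refine ENNReal.ofReal_le_ofReal ?_
    exact le_trans (Nat.cast_le.2 (sum_card_nonempty_le hs hq'))
      (sum_closed_le_sqrt_two hn hB hT _ (sum_closedTransmitted_le hs hq))
  have hopt := le_optTransmitted hq' hn hB
  rw [← ENNReal.ofReal_natCast] at hopt
  refine le_trans ?_ (le_iSup₂ (f := fun (τ : Instance (n + T) B) (_ : τ.FiniteDuration) =>
    optTransmitted τ / (A.run τ).transmitted) _ (burstInstance_finiteDuration B n T q))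
  refine le_trans (le_of_eq ?_) (ENNReal.div_le_div hopt halg)
  have hT' : (0 : ℝ) < T := by exact_mod_cast hTpos
  rw [← ENNReal.ofReal_div_of_pos (by positivity)]
  congr 1
  push_cast
  field_simp

end SharedMemorySwitch

theorem mainTheorem1
    (ALG : ∀ N B : ℕ, SharedMemorySwitch.OnlineAlgorithm N B) :
    ENNReal.ofReal (Real.sqrt 2) ≤ ⨆ (N : ℕ) (B : ℕ), (ALG N B).competitiveRatio := by
  have hle : ∀ n : ℕ, 1 ≤ n → ENNReal.ofReal (2 * n / (√2 * n + 3))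
      ≤ ⨆ (N : ℕ) (B : ℕ), (ALG N B).competitiveRatio := by
    intro n hn
    have hB : 2 * (n * (n + 3) / 2) = n * (n + 3) := by
      refine Nat.two_mul_div_two_of_even ?_
      rcases Nat.even_or_odd n with h | h
      · exact h.mul_right _
      · exact (h.add_odd (by decide)).mul_left _
    exact (SharedMemorySwitch.le_competitiveRatio hn hB rfl (ALG _ _)).trans
      (le_iSup₂ (f := fun N B => (ALG N B).competitiveRatio) _ _)
  have hs : 0 < √2 := Real.sqrt_pos.2 (by norm_num)
  have hlim : Filter.Tendsto (fun n : ℕ => 2 * (n : ℝ) / (√2 * n + 3)) Filter.atTop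
      (nhds √2) := by
    have h1 : Filter.Tendsto (fun n : ℕ => 2 / (√2 + 3 / (n : ℝ))) Filter.atTop
        (nhds (2 / (√2 + 0))) :=
      tendsto_const_nhds.div (tendsto_const_nhds.add (tendsto_const_div_atTop_nhds_zero_nat 3))
        (by positivity)
    rw [add_zero, Real.div_sqrt] at h1
    refine h1.congr' ?_
    filter_upwards [Filter.eventually_ge_atTop 1] with n hn
    have : (0 : ℝ) < n := by exact_mod_cast hn
    field_simp
  refine le_of_tendsto ((ENNReal.continuous_ofReal.tendsto _).comp hlim) ?_
  filter_upwards [Filter.eventually_ge_atTop 1] with n hn using hle n hn
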